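/- Let $n\ge 1$ and $0<m<1/2$, and let $$E_{2m}=\{z\in\mathbb C^n : |z_1|^{2m}+|z_2|^2+\dots+|z_n|^2<1\}.$$ For $a\in E_{2m}$ and $v\in\mathbb C^n\cong T_aE_{2m}$ let $$K(a,v)=\inf\{c>0 : \text{there is a holomorphic } \varphi:\mathbb D\to E_{2m} \text{ with } \varphi(0)=a,\ c\,\varphi'(0)=v\}$$ be the Kobayashi metric, where $\mathbb D$ is the open unit disc. The Wu metric of $E_{2m}$ at $a$ is the positive definite Hermitian inner product $h_a$ on $\mathbb C^n$ whose closed unit ball $\{v : h_a(v,v)\le 1\}$ has the least Lebesgue volume among the closed unit balls of all Hermitian inner products on $\mathbb C^n$ that contain the Kobayashi indicatrix $\{v : K(a,v)\le 1\}$. Then there are functions $r_1,r_2$ of $p$, real-valued, positive and continuous on $\{p\in\mathbb C : (p,\hat 0)\in E_{2m}\}$, where $\hat 0=(0,\dots,0)\in\mathbb C^{n-1}$, such that for every $(p,\hat 0)\in E_{2m}$ the Wu metric at $(p,\hat 0)$ exists, is unique, and has the unit sphere $$\{v\in\mathbb C^n : r_1(p)\,|v_1|^2+r_2(p)\,(|v_2|^2+\dots+|v_n|^2)=1\}.$$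 -/

import Mathlib

open MeasureTheory
open scoped Matrix ComplexOrder

/-- The pseudo-egg `{z ∈ ℂⁿ⁺¹ : |z₁|^{2m} + |z₂|² + ⋯ + |zₙ₊₁|² < 1}`. The first coordinate is `z 0`,
the remaining ones are `z i.succ`. -/
def pseudoEgg (n : ℕ) (m : ℝ) : Set (Fin (n + 1) → ℂ) :=
  {z | ‖z 0‖ ^ (2 * m) + ∑ i : Fin n, ‖z i.succ‖ ^ 2 < 1}

/-- The infinitesimal Kobayashi metric of a domain `D ⊆ ℂᴺ` at `a ∈ D` in the direction `v`: the
infimum of all `c > 0` such that `c • φ'(0) = v` for some holomorphic map `φ` from the unit disc to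
`D` with `φ(0) = a`. -/
noncomputable def kobayashiMetric {N : ℕ} (D : Set (Fin N → ℂ)) (a v : Fin N → ℂ) : ℝ :=
  sInf {c : ℝ | 0 < c ∧ ∃ φ : ℂ → (Fin N → ℂ),
    DifferentiableOn ℂ φ (Metric.ball 0 1) ∧ Set.MapsTo φ (Metric.ball 0 1) D ∧
      φ 0 = a ∧ (c : ℂ) • deriv φ 0 = v}

/-- The closed unit ball of the Kobayashi metric in the tangent space at `a`. -/
def kobayashiIndicatrix {N : ℕ} (D : Set (Fin N → ℂ)) (a : Fin N → ℂ) : Set (Fin N → ℂ) :=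
  {v | kobayashiMetric D a v ≤ 1}

/-- The quadratic form `v ↦ v* H v` of a Hermitian matrix `H`. -/
noncomputable def hermitianSq {N : ℕ} (H : Matrix (Fin N) (Fin N) ℂ) (v : Fin N → ℂ) : ℝ :=
  (star v ⬝ᵥ (H *ᵥ v)).re

/-- The closed unit ball (a complex ellipsoid centred at the origin) of the Hermitian inner product
with matrix `H`. -/
def hermitianBall {N : ℕ} (H : Matrix (Fin N) (Fin N) ℂ) : Set (Fin N → ℂ) :=
  {v | hermitianSq H v ≤ 1}

/-- The unit sphere of the Hermitian inner product with matrix `H`. -/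
def hermitianSphere {N : ℕ} (H : Matrix (Fin N) (Fin N) ℂ) : Set (Fin N → ℂ) :=
  {v | hermitianSq H v = 1}

/-- `H` is the matrix of the Wu metric of `D` at `a`: it is positive definite, its unit ball
contains the Kobayashi indicatrix at `a`, and it has the least Lebesgue volume among the unit balls
of all Hermitian inner products with this property (the best fitting ellipsoid). -/
structure IsWuMetricAt {N : ℕ} (D : Set (Fin N → ℂ)) (a : Fin N → ℂ)
    (H : Matrix (Fin N) (Fin N) ℂ) : Prop where
  posDef : H.PosDef
  indicatrix_subset : kobayashiIndicatrix D a ⊆ hermitianBall H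
  volume_le : ∀ H' : Matrix (Fin N) (Fin N) ℂ, H'.PosDef →
    kobayashiIndicatrix D a ⊆ hermitianBall H' →
      volume (hermitianBall H) ≤ volume (hermitianBall H')

/-! The volume of the unit ball of a Hermitian form `H` is a constant divided by `det H`
(`volume_hermitianBall`), so the Wu metric maximises the determinant over the forms whose ball
contains the indicatrix. The indicatrix contains a ball, so the admissible semidefinite forms are a
compact set and a maximum exists; it is bounded, so the maximum is positive. Midpoints of admissible
forms are admissible, and `Matrix.PosDef.re_det_lt_re_det_midpoint` then makes the maximiser unique.

By uniqueness the maximiser inherits the linear symmetries of the egg fixing `(p, 0)`. Sign changes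
of the later coordinates make `H` diagonal, and permutations of them make its later entries equal.

Continuity in `p` needs no formula for the indicatrix. Nearby points `(q, 0)` and `(p, 0)` are
exchanged by affine self-maps of the egg with linear part near the identity (`eggContraction`).
Since such maps do not increase the Kobayashi metric, the indicatrices almost contain one another,
and compactness with uniqueness gives convergence of the maximisers (`IsBestFit.tendsto`). -/

/-! ### Positive semidefinite matrices, determinants and volumes of ellipsoids. -/

section MatrixFacts

variable {N : ℕ}

open scoped MatrixOrder in
lemma Matrix.PosDef.exists_eq_conjTranspose_mul_self {H : Matrix (Fin N) (Fin N) ℂ}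
    (hH : H.PosDef) : ∃ B : Matrix (Fin N) (Fin N) ℂ, IsUnit B.det ∧ H = Bᴴ * B := by
  obtain ⟨B, hB⟩ := CStarAlgebra.nonneg_iff_eq_star_mul_self.mp hH.posSemidef.nonneg
  refine ⟨B, ?_, hB⟩
  have hdet : H.det ≠ 0 := hH.det_pos.ne'
  rw [hB, Matrix.det_mul] at hdet
  exact (right_ne_zero_of_mul hdet).isUnit

lemma hermitianSq_conjTranspose_mul_mul (H S : Matrix (Fin N) (Fin N) ℂ) (v : Fin N → ℂ) :
    hermitianSq (Sᴴ * H * S) v = hermitianSq H (S *ᵥ v) := by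
  unfold hermitianSq
  rw [Matrix.star_mulVec, ← Matrix.mulVec_mulVec, ← Matrix.mulVec_mulVec,
    Matrix.dotProduct_mulVec (star v) Sᴴ]

lemma hermitianSq_add (A B : Matrix (Fin N) (Fin N) ℂ) (v : Fin N → ℂ) :
    hermitianSq (A + B) v = hermitianSq A v + hermitianSq B v := by
  simp [hermitianSq, Matrix.add_mulVec]

lemma hermitianSq_smul (t : ℝ) (A : Matrix (Fin N) (Fin N) ℂ) (v : Fin N → ℂ) :
    hermitianSq (t • A) v = t * hermitianSq A v := by
  simp [hermitianSq, Matrix.smul_mulVec]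

lemma hermitianSq_one (v : Fin N → ℂ) :
    hermitianSq (1 : Matrix (Fin N) (Fin N) ℂ) v = ∑ i, ‖v i‖ ^ 2 := by
  simp only [hermitianSq, Matrix.one_mulVec, dotProduct, Complex.re_sum]
  refine Finset.sum_congr rfl fun i _ => ?_
  rw [Pi.star_apply, Complex.star_def, Complex.conj_mul']
  norm_cast

lemma hermitianSq_diagonal (d : Fin N → ℝ) (v : Fin N → ℂ) :
    hermitianSq (Matrix.diagonal fun i => (d i : ℂ)) v = ∑ i, d i * ‖v i‖ ^ 2 := by
  simp only [hermitianSq, Matrix.mulVec_diagonal, dotProduct, Complex.re_sum]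
  refine Finset.sum_congr rfl fun i _ => ?_
  rw [Pi.star_apply, Complex.star_def, mul_left_comm, Complex.conj_mul']
  norm_cast

lemma continuous_hermitianSq_left (v : Fin N → ℂ) :
    Continuous fun H : Matrix (Fin N) (Fin N) ℂ => hermitianSq H v := by
  unfold hermitianSq
  fun_prop

lemma isClosed_setOf_posSemidef : IsClosed {H : Matrix (Fin N) (Fin N) ℂ | H.PosSemidef} := by
  simp only [Matrix.posSemidef_iff_dotProduct_mulVec, Set.ofPred_and, Set.ofPred_forall]
  refine IsClosed.inter ?_ (isClosed_iInter fun x => ?_)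
  · exact isClosed_eq (Continuous.matrix_conjTranspose continuous_id) continuous_id
  · exact isClosed_le continuous_const (by fun_prop)

/-- The off-diagonal entries of a positive semidefinite matrix are controlled by its diagonal. -/
lemma Matrix.PosSemidef.norm_apply_le {H : Matrix (Fin N) (Fin N) ℂ} (hH : H.PosSemidef)
    (i j : Fin N) : ‖H i j‖ ≤ ((H i i).re + (H j j).re) / 2 := by
  obtain ⟨w, hw, hwH⟩ : ∃ w : ℂ, ‖w‖ = 1 ∧ w * H i j = ‖H i j‖ := by
    by_cases h0 : H i j = 0
    · exact ⟨1, by simp, by simp [h0]⟩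
    · refine ⟨‖H i j‖ / H i j, by simp [h0], by field_simp⟩
  have hsymm : H j i = star (H i j) := by
    conv_lhs => rw [← hH.isHermitian]
    rfl
  -- Testing the form on `e i - w • e j`, with `w` the phase chosen above, gives `0 ≤ H i i + H j j
  -- - 2 * ‖H i j‖` in real parts.
  have h := hH.re_dotProduct_nonneg (Pi.single i 1 - Pi.single j w)
  have e : star (Pi.single i 1 - Pi.single j w : Fin N → ℂ) ⬝ᵥ
      (H *ᵥ (Pi.single i 1 - Pi.single j w)) =
      H i i + H j j * (star w * w) - w * H i j - star (w * H i j) := by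
    rw [Matrix.mulVec_sub, star_sub, sub_dotProduct, dotProduct_sub, dotProduct_sub]
    rw [← Pi.single_star, ← Pi.single_star]
    simp [Matrix.mulVec_single, hsymm]
    ring
  have hww : star w * w = 1 := by
    have := Complex.conj_mul' w
    rw [hw] at this
    simpa using this
  rw [e, hww, hwH] at h
  simp at h
  linarith

lemma det_one_add_of_isHermitian {M : Matrix (Fin N) (Fin N) ℂ} (hM : M.IsHermitian) :
    (1 + M).det = ∏ i, (1 + (hM.eigenvalues i : ℂ)) := by
  have h := Matrix.eval_charpoly M (-1)
  have e : Matrix.scalar (Fin N) (-1 : ℂ) - M = -(1 + M) := by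
    rw [map_neg, map_one]; abel
  rw [e, Matrix.det_neg, hM.charpoly_eq, Polynomial.eval_prod] at h
  simp only [Polynomial.eval_sub, Polynomial.eval_X, Polynomial.eval_C] at h
  have e2 : ∏ i, (-1 - (hM.eigenvalues i : ℂ)) = (-1) ^ N * ∏ i, (1 + (hM.eigenvalues i : ℂ)) := by
    have : ∀ i, (-1 - (hM.eigenvalues i : ℂ)) = (-1) * (1 + (hM.eigenvalues i : ℂ)) :=
      fun i => by ring
    simp only [this, Finset.prod_mul_distrib, Finset.prod_const, Finset.card_univ, Fintype.card_fin]
  have h' : (-1 : ℂ) ^ N * ∏ i, (1 + (hM.eigenvalues i : ℂ)) = (-1) ^ N * (1 + M).det := by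
    rw [← e2]; simpa using h
  exact (mul_left_cancel₀ (pow_ne_zero _ (by norm_num)) h').symm

lemma Matrix.IsHermitian.eq_one_of_eigenvalues_eq_one {M : Matrix (Fin N) (Fin N) ℂ}
    (hM : M.IsHermitian) (h : ∀ i, hM.eigenvalues i = 1) : M = 1 := by
  have e := hM.spectral_theorem
  have : (RCLike.ofReal ∘ hM.eigenvalues : Fin N → ℂ) = fun _ => 1 := by
    funext i; simp [h i]
  rw [this, Matrix.diagonal_one, map_one] at e
  exact e

/-- A positive definite matrix `M ≠ 1` of determinant one has `det (1 + M) > 2 ^ N`. -/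
lemma Matrix.PosDef.two_pow_lt_det_one_add {M : Matrix (Fin N) (Fin N) ℂ} (hM : M.PosDef)
    (hdet : M.det = 1) (hne : M ≠ 1) : (2 : ℝ) ^ N < (1 + M).det.re := by
  set l := hM.isHermitian.eigenvalues with hl
  have hpos : ∀ i, 0 < l i := hM.eigenvalues_pos
  have hprod : ∏ i, l i = 1 := by
    have := hM.isHermitian.det_eq_prod_eigenvalues
    rw [hdet] at this
    have h : ((∏ i, l i : ℝ) : ℂ) = 1 := by push_cast; exact this.symm
    exact_mod_cast h
  have hre : (1 + M).det.re = ∏ i, (1 + l i) := by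
    have e : (1 + M).det = ((∏ i, (1 + l i) : ℝ) : ℂ) := by
      rw [det_one_add_of_isHermitian hM.isHermitian]; push_cast; rfl
    rw [e, Complex.ofReal_re]
  obtain ⟨i, hi⟩ : ∃ i, l i ≠ 1 := by
    by_contra! h
    exact hne (hM.isHermitian.eq_one_of_eigenvalues_eq_one h)
  -- AM-GM `4 * l ≤ (1 + l) ^ 2` for each eigenvalue, strict where `l ≠ 1`; the eigenvalues have
  -- product one.
  have hlt : ∏ i, (4 * l i) < ∏ i, (1 + l i) ^ 2 := by
    refine Finset.prod_lt_prod (fun i _ => by have := hpos i; positivity)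
      (fun i _ => by nlinarith [sq_nonneg (1 - l i)]) ⟨i, Finset.mem_univ i, ?_⟩
    have : 0 < (1 - l i) ^ 2 := by
      have : 1 - l i ≠ 0 := sub_ne_zero.mpr hi.symm
      positivity
    nlinarith
  rw [Finset.prod_mul_distrib, hprod, Finset.prod_pow, Finset.prod_const, Finset.card_univ,
    Fintype.card_fin, mul_one] at hlt
  rw [hre]
  refine lt_of_pow_lt_pow_left₀ 2 (Finset.prod_nonneg fun i _ => by linarith [hpos i]) ?_
  calc ((2 : ℝ) ^ N) ^ 2 = 4 ^ N := by rw [← pow_mul, mul_comm, pow_mul]; norm_num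
    _ < _ := hlt

lemma Matrix.PosSemidef.ofReal_re_det {A : Matrix (Fin N) (Fin N) ℂ} (hA : A.PosSemidef) :
    ((A.det.re : ℝ) : ℂ) = A.det := by
  have := Complex.le_def.mp hA.det_nonneg
  apply Complex.ext <;> simp [← this.2]

lemma Matrix.PosDef.re_det_pos {A : Matrix (Fin N) (Fin N) ℂ} (hA : A.PosDef) :
    0 < A.det.re := by
  simpa using (Complex.lt_def.mp hA.det_pos).1

lemma re_det_conjTranspose_mul_mul (A C : Matrix (Fin N) (Fin N) ℂ) :
    (Cᴴ * A * C).det.re = ‖C.det‖ ^ 2 * A.det.re := by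
  have h : (Cᴴ * A * C).det = ((‖C.det‖ ^ 2 : ℝ) : ℂ) * A.det := by
    rw [Matrix.det_mul, Matrix.det_mul, Matrix.det_conjTranspose, mul_right_comm]
    congr 1
    simpa using Complex.conj_mul' C.det
  rw [h, Complex.re_ofReal_mul]

/-- Strict concavity of the determinant along midpoints of positive definite matrices. -/
lemma Matrix.PosDef.re_det_lt_re_det_midpoint {A B : Matrix (Fin N) (Fin N) ℂ} (hA : A.PosDef)
    (hB : B.PosDef) (hdet : A.det.re = B.det.re) (hne : A ≠ B) :
    A.det.re < ((1 / 2 : ℝ) • (A + B)).det.re := by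
  obtain ⟨C, hC, rfl⟩ := hA.exists_eq_conjTranspose_mul_self
  have hCi : C⁻¹ * C = 1 := Matrix.nonsing_inv_mul C hC
  have hCi' : Cᴴ * (C⁻¹)ᴴ = 1 := by rw [← Matrix.conjTranspose_mul, hCi, Matrix.conjTranspose_one]
  -- Congruence by `C⁻¹` takes `A` to the identity and `B` to `M`; equality of the determinants
  -- becomes `M.det = 1`.
  set M := (C⁻¹)ᴴ * B * C⁻¹ with hMdef
  have hBM : B = Cᴴ * M * C := by
    rw [hMdef]
    calc B = (Cᴴ * (C⁻¹)ᴴ) * B * (C⁻¹ * C) := by rw [hCi, hCi']; simp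
      _ = _ := by simp only [Matrix.mul_assoc]
  have hM : M.PosDef := by
    refine hB.conjTranspose_mul_mul_same ?_
    rw [Matrix.mulVec_injective_iff_isUnit, Matrix.isUnit_iff_isUnit_det]
    exact Matrix.isUnit_nonsing_inv_det C hC
  have hCn : 0 < ‖C.det‖ ^ 2 := by
    have := hC.ne_zero
    positivity
  have hCC : (Cᴴ * C).det.re = ‖C.det‖ ^ 2 := by
    simpa using re_det_conjTranspose_mul_mul 1 C
  have hM1 : M.det = 1 := by
    have h1 : M.det.re = 1 := by
      rw [hCC, hBM, re_det_conjTranspose_mul_mul] at hdet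
      exact (mul_left_cancel₀ hCn.ne' (by rw [mul_one]; exact hdet)).symm
    rw [← hM.posSemidef.ofReal_re_det, h1, Complex.ofReal_one]
  have hMne : M ≠ 1 := by
    rintro h
    apply hne
    rw [hBM, h, Matrix.mul_one]
  have key := hM.two_pow_lt_det_one_add hM1 hMne
  have e : (1 / 2 : ℝ) • (Cᴴ * C + B) = Cᴴ * ((1 / 2 : ℝ) • (1 + M)) * C := by
    rw [hBM, Matrix.mul_smul, Matrix.smul_mul, Matrix.mul_add, Matrix.add_mul, Matrix.mul_one]
  have e2 : ((1 / 2 : ℝ) • (1 + M)).det.re = (1 / 2 : ℝ) ^ N * (1 + M).det.re := by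
    have : (1 / 2 : ℝ) • (1 + M) = ((1 / 2 : ℝ) : ℂ) • (1 + M) := by
      ext i j; simp [mul_add]
    rw [this, Matrix.det_smul, Fintype.card_fin, ← Complex.ofReal_pow, Complex.re_ofReal_mul]
  rw [e, re_det_conjTranspose_mul_mul, e2, hCC]
  have : (1 : ℝ) < (1 / 2 : ℝ) ^ N * (1 + M).det.re := by
    calc (1 : ℝ) = (1 / 2 : ℝ) ^ N * 2 ^ N := by rw [← mul_pow]; norm_num
      _ < _ := by gcongr
  nlinarith

/-- The volume of a complex ellipsoid is inversely proportional to the determinant. -/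
lemma volume_hermitianBall {H : Matrix (Fin N) (Fin N) ℂ} (hH : H.PosDef) :
    volume (hermitianBall H) =
      ENNReal.ofReal (H.det.re)⁻¹ * volume (hermitianBall (1 : Matrix (Fin N) (Fin N) ℂ)) := by
  obtain ⟨B, hB, rfl⟩ := hH.exists_eq_conjTranspose_mul_self
  have hdet : LinearMap.det ((Matrix.toLin' B).restrictScalars ℝ) = ‖B.det‖ ^ 2 := by
    rw [LinearMap.det_restrictScalars, LinearMap.det_toLin', Algebra.norm_complex_eq]
    simp [Complex.normSq_eq_norm_sq]
  have hpos : 0 < ‖B.det‖ ^ 2 := by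
    have := hB.ne_zero
    positivity
  have hpre : hermitianBall (Bᴴ * B) =
      (Matrix.toLin' B).restrictScalars ℝ ⁻¹' hermitianBall (1 : Matrix (Fin N) (Fin N) ℂ) := by
    ext v
    have := hermitianSq_conjTranspose_mul_mul 1 B v
    rw [Matrix.mul_one] at this
    simp [hermitianBall, this]
  rw [hpre, Measure.addHaar_preimage_linearMap volume (by rw [hdet]; exact hpos.ne'), hdet,
    abs_of_pos (by positivity)]
  have := re_det_conjTranspose_mul_mul 1 B
  simp only [Matrix.det_one, Complex.one_re, mul_one] at this
  rw [this]

lemma volume_hermitianBall_one_ne_zero :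
    volume (hermitianBall (1 : Matrix (Fin N) (Fin N) ℂ)) ≠ 0 := by
  have hopen : IsOpen {v : Fin N → ℂ | ∑ i, ‖v i‖ ^ 2 < 1} :=
    isOpen_lt (by fun_prop) continuous_const
  have hpos := hopen.measure_pos volume ⟨0, by simp⟩
  refine (hpos.trans_le (measure_mono fun v hv => ?_)).ne'
  simp only [hermitianBall, Set.mem_ofPred_eq, hermitianSq_one]
  exact le_of_lt hv

lemma volume_hermitianBall_one_ne_top :
    volume (hermitianBall (1 : Matrix (Fin N) (Fin N) ℂ)) ≠ ⊤ := by
  refine ((measure_mono fun v hv => ?_).trans_lt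
    (measure_closedBall_lt_top (x := (0 : Fin N → ℂ)) (r := 1))).ne
  simp only [hermitianBall, Set.mem_ofPred_eq, hermitianSq_one] at hv
  rw [mem_closedBall_zero_iff, pi_norm_le_iff_of_nonneg zero_le_one]
  intro i
  have : ‖v i‖ ^ 2 ≤ ∑ i, ‖v i‖ ^ 2 :=
    Finset.single_le_sum (f := fun i => ‖v i‖ ^ 2) (fun i _ => by positivity) (Finset.mem_univ i)
  exact (sq_le_one_iff₀ (norm_nonneg _)).mp (this.trans hv)

lemma volume_hermitianBall_le_iff {A B : Matrix (Fin N) (Fin N) ℂ} (hA : A.PosDef)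
    (hB : B.PosDef) :
    volume (hermitianBall A) ≤ volume (hermitianBall B) ↔ B.det.re ≤ A.det.re := by
  rw [volume_hermitianBall hA, volume_hermitianBall hB,
    ENNReal.mul_le_mul_iff_left volume_hermitianBall_one_ne_zero volume_hermitianBall_one_ne_top,
    ENNReal.ofReal_le_ofReal_iff (inv_nonneg.mpr hB.re_det_pos.le),
    inv_le_inv₀ hA.re_det_pos hB.re_det_pos]

end MatrixFacts

/-! ### Existence, uniqueness, symmetry and stability of the best fitting ellipsoid. -/

section BestFittingEllipsoid

open Filter Topology

variable {N : ℕ}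

/-- The positive semidefinite matrices whose closed unit ball contains `I`. -/
def circumscribedForms (I : Set (Fin N → ℂ)) : Set (Matrix (Fin N) (Fin N) ℂ) :=
  {H | H.PosSemidef ∧ I ⊆ hermitianBall H}

/-- `H` has the largest determinant among the positive semidefinite matrices whose closed unit
ball contains `I`. -/
structure IsBestFit (I : Set (Fin N → ℂ)) (H : Matrix (Fin N) (Fin N) ℂ) : Prop where
  posDef : H.PosDef
  subset : I ⊆ hermitianBall H
  det_le : ∀ H' ∈ circumscribedForms I, H'.det.re ≤ H.det.re

/-- Singular competitors are harmless because their determinant is zero; admitting them makes the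
set of competitors closed. -/
lemma isWuMetricAt_iff_isBestFit {D : Set (Fin N → ℂ)} {a : Fin N → ℂ}
    {H : Matrix (Fin N) (Fin N) ℂ} :
    IsWuMetricAt D a H ↔ IsBestFit (kobayashiIndicatrix D a) H := by
  constructor
  · rintro ⟨h1, h2, h3⟩
    refine ⟨h1, h2, fun H' hH' => ?_⟩
    by_cases h0 : H'.det = 0
    · rw [h0]; exact h1.re_det_pos.le
    · have hpd : H'.PosDef := hH'.1.posDef_iff_det_ne_zero.mpr h0
      exact (volume_hermitianBall_le_iff h1 hpd).mp (h3 H' hpd hH'.2)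
  · rintro ⟨h1, h2, h3⟩
    exact ⟨h1, h2, fun H' hpd hH' =>
      (volume_hermitianBall_le_iff h1 hpd).mpr (h3 H' ⟨hpd.posSemidef, hH'⟩)⟩

lemma isClosed_circumscribedForms (I : Set (Fin N → ℂ)) : IsClosed (circumscribedForms I) := by
  have : circumscribedForms I = {H | H.PosSemidef} ∩ ⋂ v ∈ I, {H | hermitianSq H v ≤ 1} := by
    ext H
    simp [circumscribedForms, hermitianBall, Set.subset_def]
  rw [this]
  exact isClosed_setOf_posSemidef.inter (isClosed_biInter fun v _ =>
    isClosed_le (continuous_hermitianSq_left v) continuous_const)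

/-- The vectors `δ • e i` lie in `I` and bound the diagonal of `H`; semidefiniteness then bounds
every entry. -/
lemma isCompact_circumscribedForms {I : Set (Fin N → ℂ)} {δ : ℝ} (hδ : 0 < δ)
    (hI : Metric.closedBall 0 δ ⊆ I) : IsCompact (circumscribedForms I) := by
  have hK : IsCompact (Set.univ.pi fun _ : Fin N => Set.univ.pi fun _ : Fin N =>
      Metric.closedBall (0 : ℂ) (1 / δ ^ 2)) :=
    isCompact_univ_pi fun _ => isCompact_univ_pi fun _ => isCompact_closedBall _ _
  refine hK.of_isClosed_subset (isClosed_circumscribedForms I) ?_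
  intro (H : Matrix (Fin N) (Fin N) ℂ) hH
  have hdiag : ∀ i, (H i i).re ≤ 1 / δ ^ 2 := by
    intro i
    have hv : (Pi.single i (δ : ℂ) : Fin N → ℂ) ∈ I := by
      apply hI
      rw [mem_closedBall_zero_iff, Pi.norm_single]
      simp [abs_of_pos hδ]
    have h := hH.2 hv
    have e : hermitianSq H (Pi.single i (δ : ℂ)) = δ ^ 2 * (H i i).re := by
      unfold hermitianSq
      rw [← Pi.single_star]
      simp
      ring
    simp only [hermitianBall, Set.mem_ofPred_eq, e] at h
    rw [le_div_iff₀ (by positivity)]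
    linarith
  intro i _ j _
  rw [mem_closedBall_zero_iff]
  have := hH.1.norm_apply_le i j
  linarith [hdiag i, hdiag j]

lemma exists_isBestFit {I : Set (Fin N → ℂ)} {δ R : ℝ} (hδ : 0 < δ)
    (hI : Metric.closedBall 0 δ ⊆ I) (hR : I ⊆ Metric.closedBall 0 R) :
    ∃ H, IsBestFit I H := by
  -- A multiple of the identity small enough that its ball contains `I`; the `+ 1` keeps `t` defined
  -- and positive even if `N * R ^ 2 = 0`. It shows that the maximal determinant is positive.
  set t : ℝ := (N * R ^ 2 + 1)⁻¹ with ht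
  have ht0 : 0 < t := by positivity
  have hpd : (t • (1 : Matrix (Fin N) (Fin N) ℂ)).PosDef := Matrix.PosDef.one.smul ht0
  have hmem : t • (1 : Matrix (Fin N) (Fin N) ℂ) ∈ circumscribedForms I := by
    refine ⟨hpd.posSemidef, fun v hv => ?_⟩
    simp only [hermitianBall, Set.mem_ofPred_eq]
    rw [hermitianSq_smul, hermitianSq_one, ht, inv_mul_le_one₀ (by positivity)]
    have hv' := hR hv
    rw [mem_closedBall_zero_iff] at hv'
    calc ∑ i, ‖v i‖ ^ 2 ≤ ∑ _i : Fin N, R ^ 2 :=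
          Finset.sum_le_sum fun i _ => by
            have := (norm_le_pi_norm v i).trans hv'
            gcongr
      _ = N * R ^ 2 := by simp
      _ ≤ _ := by linarith
  obtain ⟨H, hH, hmax⟩ := (isCompact_circumscribedForms hδ hI).exists_isMaxOn ⟨_, hmem⟩
    (f := fun H => H.det.re) (Complex.continuous_re.comp (Continuous.matrix_det continuous_id)).continuousOn
  have hdet : 0 < H.det.re := hpd.re_det_pos.trans_le (hmax hmem)
  refine ⟨H, hH.1.posDef_iff_det_ne_zero.mpr fun h0 => ?_, hH.2, fun H' hH' => hmax hH'⟩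
  rw [h0] at hdet
  exact lt_irrefl _ hdet

lemma IsBestFit.unique {I : Set (Fin N → ℂ)} {A B : Matrix (Fin N) (Fin N) ℂ}
    (hA : IsBestFit I A) (hB : IsBestFit I B) : A = B := by
  by_contra hne
  have hdet : A.det.re = B.det.re :=
    le_antisymm (hB.det_le A ⟨hA.posDef.posSemidef, hA.subset⟩)
      (hA.det_le B ⟨hB.posDef.posSemidef, hB.subset⟩)
  refine absurd (hA.posDef.re_det_lt_re_det_midpoint hB.posDef hdet hne) (not_lt.mpr ?_)
  refine hA.det_le _ ⟨((hA.posDef.add hB.posDef).smul (by norm_num)).posSemidef, fun v hv => ?_⟩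
  have h1 := hA.subset hv
  have h2 := hB.subset hv
  simp only [hermitianBall, Set.mem_ofPred_eq] at h1 h2 ⊢
  rw [hermitianSq_smul, hermitianSq_add]
  linarith

lemma conjTranspose_mul_mul_mem_circumscribedForms {I J : Set (Fin N → ℂ)}
    {H S : Matrix (Fin N) (Fin N) ℂ} (hH : H ∈ circumscribedForms J)
    (hS : ∀ v ∈ I, S *ᵥ v ∈ J) : Sᴴ * H * S ∈ circumscribedForms I := by
  refine ⟨hH.1.conjTranspose_mul_mul_same S, fun v hv => ?_⟩
  have := hH.2 (hS v hv)
  simpa only [hermitianBall, Set.mem_ofPred_eq, hermitianSq_conjTranspose_mul_mul] using this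

lemma IsBestFit.mem {I : Set (Fin N → ℂ)} {H : Matrix (Fin N) (Fin N) ℂ} (hH : IsBestFit I H) :
    H ∈ circumscribedForms I :=
  ⟨hH.posDef.posSemidef, hH.subset⟩

/-- The best fitting ellipsoid inherits the volume preserving linear symmetries of the set. -/
lemma IsBestFit.conjTranspose_mul_mul_eq {I : Set (Fin N → ℂ)} {H S : Matrix (Fin N) (Fin N) ℂ}
    (hH : IsBestFit I H) (hdet : ‖S.det‖ = 1) (hS : ∀ v ∈ I, S *ᵥ v ∈ I) : Sᴴ * H * S = H := by
  have hmem := conjTranspose_mul_mul_mem_circumscribedForms hH.mem hS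
  have hd : (Sᴴ * H * S).det.re = H.det.re := by
    rw [re_det_conjTranspose_mul_mul, hdet, one_pow, one_mul]
  refine IsBestFit.unique (I := I) ⟨hmem.1.posDef_iff_det_ne_zero.mpr fun h0 => ?_, hmem.2,
    fun H' hH' => hd ▸ hH.det_le H' hH'⟩ hH
  rw [h0] at hd
  exact hH.posDef.re_det_pos.ne hd

/-- If the sets `I x` converge to `J`, in the sense that linear maps tending to the identity map
them into one another, then so do the best fitting ellipsoids. -/
lemma IsBestFit.tendsto {X : Type*} {l : Filter X} {J : Set (Fin N → ℂ)}
    {I : X → Set (Fin N → ℂ)} {H₀ : Matrix (Fin N) (Fin N) ℂ}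
    {H S T : X → Matrix (Fin N) (Fin N) ℂ} {δ : ℝ} (hδ : 0 < δ)
    (hJ : Metric.closedBall 0 δ ⊆ J) (hH₀ : IsBestFit J H₀) (hH : ∀ᶠ x in l, IsBestFit (I x) (H x))
    (hS : Tendsto S l (𝓝 1)) (hT : Tendsto T l (𝓝 1))
    (hSI : ∀ᶠ x in l, ∀ v ∈ I x, S x *ᵥ v ∈ J) (hTJ : ∀ᶠ x in l, ∀ v ∈ J, T x *ᵥ v ∈ I x) :
    Tendsto H l (𝓝 H₀) := by
  have hcont : Continuous fun A : Matrix (Fin N) (Fin N) ℂ => A.det :=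
    Continuous.matrix_det continuous_id
  -- Pulling back by `T x` puts all forms in one compact set, the circumscribed forms of `J`. It is
  -- enough that every ultrafilter limit `G` is a best fit of `J`, hence equals `H₀`.
  have hG : Tendsto (fun x => (T x)ᴴ * H x * T x) l (𝓝 H₀) := by
    rw [tendsto_iff_ultrafilter]
    intro g hg
    have hmem : ∀ᶠ x in g, (T x)ᴴ * H x * T x ∈ circumscribedForms J := by
      filter_upwards [hg hH, hg hTJ] with x h1 h2
      exact conjTranspose_mul_mul_mem_circumscribedForms h1.mem h2
    obtain ⟨G, hGmem, hGlim⟩ := (isCompact_circumscribedForms hδ hJ).ultrafilter_le_nhds'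
      (g.map fun x => (T x)ᴴ * H x * T x) hmem
    have hGlim' : Tendsto (fun x => (T x)ᴴ * H x * T x) g (𝓝 G) := hGlim
    -- `H₀` pulled back by `S x` competes with `H x`, so `‖det S‖ ^ 2 * det H₀ ≤ det H`; pass to the
    -- limit.
    have hdetG : H₀.det.re ≤ G.det.re := by
      have h1 : Tendsto (fun x => ((T x)ᴴ * H x * T x).det.re) g (𝓝 G.det.re) :=
        ((Complex.continuous_re.comp hcont).tendsto G).comp hGlim'
      have h2 : Tendsto (fun x => ‖(T x).det‖ ^ 2 * (‖(S x).det‖ ^ 2 * H₀.det.re)) g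
          (𝓝 (‖(1 : Matrix (Fin N) (Fin N) ℂ).det‖ ^ 2 *
            (‖(1 : Matrix (Fin N) (Fin N) ℂ).det‖ ^ 2 * H₀.det.re))) := by
        have hT' := (((hcont.norm.tendsto 1).comp hT).mono_left hg).pow 2
        have hS' := (((hcont.norm.tendsto 1).comp hS).mono_left hg).pow 2
        exact hT'.mul (hS'.mul_const _)
      have h3 := le_of_tendsto_of_tendsto h2 h1 (by
        filter_upwards [hg hH, hg hSI] with x hx hSx
        rw [re_det_conjTranspose_mul_mul]
        have := hx.det_le _ (conjTranspose_mul_mul_mem_circumscribedForms hH₀.mem hSx)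
        rw [re_det_conjTranspose_mul_mul] at this
        gcongr)
      simpa using h3
    have hGfit : IsBestFit J G := by
      refine ⟨hGmem.1.posDef_iff_det_ne_zero.mpr fun h0 => ?_, hGmem.2,
        fun H' hH' => (hH₀.det_le H' hH').trans hdetG⟩
      rw [h0] at hdetG
      exact absurd hH₀.posDef.re_det_pos (not_lt.mpr hdetG)
    rwa [hGfit.unique hH₀] at hGlim'
  have hTinv : Tendsto (fun x => (T x)⁻¹) l (𝓝 1) := by
    have h1 : ContinuousAt (fun A : Matrix (Fin N) (Fin N) ℂ => A⁻¹) 1 := by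
      simp only [Matrix.inv_def, Ring.inverse_eq_inv']
      have hadj : Continuous fun A : Matrix (Fin N) (Fin N) ℂ => A.adjugate :=
        Continuous.matrix_adjugate continuous_id
      exact (hcont.continuousAt.inv₀ (by simp)).smul hadj.continuousAt
    have := h1.tendsto.comp hT
    rwa [inv_one] at this
  have hdetT : ∀ᶠ x in l, (T x).det ≠ 0 := by
    exact ((hcont.tendsto 1).comp hT).eventually_ne (by simp)
  have hlim : Tendsto (fun x => ((T x)⁻¹)ᴴ * ((T x)ᴴ * H x * T x) * (T x)⁻¹) l
      (𝓝 ((1 : Matrix (Fin N) (Fin N) ℂ)ᴴ * H₀ * 1)) := by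
    have hstar : Continuous fun A : Matrix (Fin N) (Fin N) ℂ => Aᴴ :=
      Continuous.matrix_conjTranspose continuous_id
    have h1 := (hstar.tendsto 1).comp hTinv
    exact (h1.mul hG).mul hTinv
  rw [Matrix.conjTranspose_one, Matrix.one_mul, Matrix.mul_one] at hlim
  refine hlim.congr' ?_
  filter_upwards [hdetT] with x hx
  have e : T x * (T x)⁻¹ = 1 := Matrix.mul_nonsing_inv _ hx.isUnit
  have e' : ((T x)⁻¹)ᴴ * (T x)ᴴ = 1 := by
    rw [← Matrix.conjTranspose_mul, e, Matrix.conjTranspose_one]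
  calc ((T x)⁻¹)ᴴ * ((T x)ᴴ * H x * T x) * (T x)⁻¹
      = (((T x)⁻¹)ᴴ * (T x)ᴴ) * H x * (T x * (T x)⁻¹) := by simp only [Matrix.mul_assoc]
    _ = H x := by rw [e, e', Matrix.one_mul, Matrix.mul_one]

end BestFittingEllipsoid

/-! ### The Kobayashi indicatrix: inner and outer balls, affine maps. -/

section Kobayashi

variable {N : ℕ}

/-- The competing constants in the definition of `kobayashiMetric`. -/
def kobayashiSet (D : Set (Fin N → ℂ)) (a v : Fin N → ℂ) : Set ℝ :=
  {c : ℝ | 0 < c ∧ ∃ φ : ℂ → (Fin N → ℂ),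
    DifferentiableOn ℂ φ (Metric.ball 0 1) ∧ Set.MapsTo φ (Metric.ball 0 1) D ∧
      φ 0 = a ∧ (c : ℂ) • deriv φ 0 = v}

lemma bddBelow_kobayashiSet (D : Set (Fin N → ℂ)) (a v : Fin N → ℂ) :
    BddBelow (kobayashiSet D a v) :=
  ⟨0, fun _ hc => hc.1.le⟩

/-- The constant `c` competes for `v` as soon as the affine disc `ζ ↦ a + ζ • v / c` stays in `D`. -/
lemma mem_kobayashiSet_of_ball_subset {D : Set (Fin N → ℂ)} {a v : Fin N → ℂ} {δ c : ℝ}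
    (hδ : 0 < δ) (hD : Metric.ball a δ ⊆ D) (hc : 0 < c) (hv : ‖v‖ ≤ δ * c) :
    c ∈ kobayashiSet D a v := by
  have hc' : (c : ℂ) ≠ 0 := by exact_mod_cast hc.ne'
  refine ⟨hc, fun ζ => a + ζ • ((c : ℂ)⁻¹ • v), ?_, ?_, by simp, ?_⟩
  · exact (by fun_prop : Differentiable ℂ fun ζ : ℂ => a + ζ • ((c : ℂ)⁻¹ • v)).differentiableOn
  · intro ζ hζ
    apply hD
    rw [mem_ball_zero_iff] at hζ
    rw [mem_ball_iff_norm, add_sub_cancel_left, norm_smul, norm_smul, norm_inv,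
      Complex.norm_real, Real.norm_of_nonneg hc.le]
    have h1 : c⁻¹ * ‖v‖ ≤ δ := by
      rw [inv_mul_le_iff₀ hc]; linarith
    calc ‖ζ‖ * (c⁻¹ * ‖v‖) ≤ ‖ζ‖ * δ := by gcongr
      _ < δ := by nlinarith
  · have h : HasDerivAt (fun ζ : ℂ => a + ζ • ((c : ℂ)⁻¹ • v)) ((1 : ℂ) • ((c : ℂ)⁻¹ • v)) 0 :=
      ((hasDerivAt_id (0 : ℂ)).smul_const _).const_add a
    rw [h.deriv, one_smul, smul_smul, mul_inv_cancel₀ hc', one_smul]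

lemma kobayashiSet_nonempty {D : Set (Fin N → ℂ)} (hD : IsOpen D) {a : Fin N → ℂ} (ha : a ∈ D)
    (v : Fin N → ℂ) : (kobayashiSet D a v).Nonempty := by
  obtain ⟨δ, hδ, hball⟩ := Metric.isOpen_iff.mp hD a ha
  refine ⟨(‖v‖ + 1) / δ, mem_kobayashiSet_of_ball_subset hδ hball (by positivity) ?_⟩
  rw [mul_div_cancel₀ _ hδ.ne']
  linarith

lemma exists_closedBall_subset_kobayashiIndicatrix {D : Set (Fin N → ℂ)} (hD : IsOpen D)
    {a : Fin N → ℂ} (ha : a ∈ D) : ∃ δ > 0, Metric.closedBall 0 δ ⊆ kobayashiIndicatrix D a := by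
  obtain ⟨δ, hδ, hball⟩ := Metric.isOpen_iff.mp hD a ha
  refine ⟨δ, hδ, fun v hv => csInf_le (bddBelow_kobayashiSet D a v) ?_⟩
  rw [mem_closedBall_zero_iff] at hv
  exact mem_kobayashiSet_of_ball_subset hδ hball one_pos (by linarith)

/-- Cauchy's estimate: the indicatrix of a bounded domain is bounded. -/
lemma kobayashiIndicatrix_subset_closedBall {D : Set (Fin N → ℂ)} (hD : IsOpen D) {R : ℝ}
    (hR : D ⊆ Metric.closedBall 0 R) {a : Fin N → ℂ} (ha : a ∈ D) :
    kobayashiIndicatrix D a ⊆ Metric.closedBall 0 (2 * R) := by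
  intro v hv
  rw [mem_closedBall_zero_iff]
  by_contra! hlt
  have hR0 : 0 ≤ R := (norm_nonneg a).trans (mem_closedBall_zero_iff.mp (hR ha))
  obtain ⟨c, ⟨hc0, φ, hφ, hmaps, rfl, rfl⟩, hclt⟩ :
      ∃ c ∈ kobayashiSet D a v, 2 * R * c < ‖v‖ := by
    -- The quotient `‖v‖ / (2 * R)` is of use only for `R > 0`; for `R = 0` any competing constant
    -- serves.
    rcases hR0.eq_or_lt with h0 | hpos
    · obtain ⟨c, hc⟩ := kobayashiSet_nonempty hD ha v
      exact ⟨c, hc, by simpa [← h0] using hlt⟩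
    · have h1 : kobayashiMetric D a v < ‖v‖ / (2 * R) :=
        lt_of_le_of_lt hv ((one_lt_div (by positivity)).mpr hlt)
      obtain ⟨c, hc, hcl⟩ := exists_lt_of_csInf_lt (kobayashiSet_nonempty hD ha v) h1
      exact ⟨c, hc, by rw [lt_div_iff₀ (by positivity)] at hcl; linarith⟩
  -- The disc lies in the ball of radius `2 * R` about its centre `φ 0`.
  have hd : ‖deriv φ 0‖ ≤ 2 * R / 1 := by
    refine Complex.norm_deriv_le_div_of_mapsTo_ball hφ (fun ζ hζ => ?_) one_pos
    rw [mem_closedBall_iff_norm]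
    have h1 := mem_closedBall_zero_iff.mp (hR (hmaps hζ))
    have h2 := mem_closedBall_zero_iff.mp (hR ha)
    linarith [norm_sub_le (φ ζ) (φ 0)]
  rw [norm_smul, Complex.norm_real, Real.norm_of_nonneg hc0.le] at hclt
  nlinarith

/-- Affine maps between domains do not increase the Kobayashi metric. -/
lemma mulVec_mem_kobayashiIndicatrix {D D' : Set (Fin N → ℂ)} (hD : IsOpen D)
    {a b : Fin N → ℂ} (ha : a ∈ D) {L : Matrix (Fin N) (Fin N) ℂ}
    (hL : ∀ z ∈ D, L *ᵥ z + b ∈ D') {v : Fin N → ℂ} (hv : v ∈ kobayashiIndicatrix D a) :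
    L *ᵥ v ∈ kobayashiIndicatrix D' (L *ᵥ a + b) := by
  refine le_trans (csInf_le_csInf (bddBelow_kobayashiSet _ _ _) (kobayashiSet_nonempty hD ha v) ?_) hv
  rintro c ⟨hc, φ, hφ, hmaps, rfl, rfl⟩
  let A : (Fin N → ℂ) →L[ℂ] (Fin N → ℂ) := L.mulVecLin.toContinuousLinearMap
  have hA : ∀ w, A w = L *ᵥ w := fun w => rfl
  refine ⟨hc, fun ζ => A (φ ζ) + b, ?_, fun ζ hζ => hL _ (hmaps hζ), rfl, ?_⟩
  · exact (A.differentiable.comp_differentiableOn hφ).add_const b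
  · have h0 : DifferentiableAt ℂ φ 0 :=
      hφ.differentiableAt (Metric.isOpen_ball.mem_nhds (by simp))
    have h : HasDerivAt (fun ζ => A (φ ζ) + b) (A (deriv φ 0)) 0 :=
      (A.hasFDerivAt.comp_hasDerivAt 0 h0.hasDerivAt).add_const b
    rw [h.deriv, hA, Matrix.mulVec_smul]

end Kobayashi

/-! ### Symmetries and affine contractions of the egg. -/

section PseudoEgg

open Filter Topology

variable {n : ℕ} {m : ℝ}

lemma isOpen_pseudoEgg (hm0 : 0 < m) : IsOpen (pseudoEgg n m) := by
  refine isOpen_lt (Continuous.add ?_ (by fun_prop)) continuous_const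
  exact (continuous_apply 0).norm.rpow_const fun _ => Or.inr (by positivity)

lemma pseudoEgg_subset_closedBall (hm0 : 0 < m) : pseudoEgg n m ⊆ Metric.closedBall 0 1 := by
  intro z hz
  have hz' : ‖z 0‖ ^ (2 * m) + ∑ i : Fin n, ‖z i.succ‖ ^ 2 < 1 := hz
  have h0 : 0 ≤ ‖z 0‖ ^ (2 * m) := by positivity
  have hs : 0 ≤ ∑ i : Fin n, ‖z i.succ‖ ^ 2 := Finset.sum_nonneg fun i _ => by positivity
  rw [mem_closedBall_zero_iff, pi_norm_le_iff_of_nonneg zero_le_one]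
  refine Fin.cases ?_ fun i => ?_
  · by_contra! h
    linarith [Real.one_lt_rpow h (by positivity : 0 < 2 * m)]
  · have : ‖z i.succ‖ ^ 2 ≤ ∑ i : Fin n, ‖z i.succ‖ ^ 2 :=
      Finset.single_le_sum (f := fun i : Fin n => ‖z i.succ‖ ^ 2) (fun i _ => by positivity)
        (Finset.mem_univ i)
    exact (sq_le_one_iff₀ (norm_nonneg _)).mp (by linarith)

lemma cons_zero_mem_pseudoEgg_iff (hm0 : 0 < m) {p : ℂ} :
    (Fin.cons p 0 : Fin (n + 1) → ℂ) ∈ pseudoEgg n m ↔ ‖p‖ < 1 := by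
  have h : ‖p‖ ^ (2 * m) < 1 ↔ ‖p‖ < 1 := by
    have := Real.rpow_lt_rpow_iff (norm_nonneg p) zero_le_one (by positivity : 0 < 2 * m)
    rwa [Real.one_rpow] at this
  simpa [pseudoEgg] using h

/-- The indicatrix at `(p, 0)`. -/
abbrev eggIndicatrix (n : ℕ) (m : ℝ) (p : ℂ) : Set (Fin (n + 1) → ℂ) :=
  kobayashiIndicatrix (pseudoEgg n m) (Fin.cons p 0)

lemma diagonal_mulVec_mem_eggIndicatrix (hm0 : 0 < m) {p : ℂ} (hp : ‖p‖ < 1)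
    {d : Fin (n + 1) → ℂ} (hd0 : d 0 = 1) (hd : ∀ i, ‖d i‖ = 1) :
    ∀ v ∈ eggIndicatrix n m p, Matrix.diagonal d *ᵥ v ∈ eggIndicatrix n m p := by
  intro v hv
  have h := mulVec_mem_kobayashiIndicatrix (D' := pseudoEgg n m) (L := Matrix.diagonal d) (b := 0)
    (isOpen_pseudoEgg hm0) ((cons_zero_mem_pseudoEgg_iff hm0).mpr hp) (fun z hz => ?_) hv
  · convert h using 2
    ext i
    refine Fin.cases ?_ (fun i => ?_) i <;> simp [Matrix.mulVec_diagonal, hd0]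
  · simpa [pseudoEgg, Matrix.mulVec_diagonal, hd] using hz

lemma permMatrix_mulVec_mem_eggIndicatrix (hm0 : 0 < m) {p : ℂ} (hp : ‖p‖ < 1) (i j : Fin n) :
    ∀ v ∈ eggIndicatrix n m p,
      (Equiv.swap i.succ j.succ).permMatrix ℂ *ᵥ v ∈ eggIndicatrix n m p := by
  intro v hv
  have hsucc : ∀ k : Fin n, Equiv.swap i.succ j.succ k.succ = (Equiv.swap i j k).succ := fun k =>
    (Fin.succ_injective n).swap_apply i j k
  have hzero : Equiv.swap i.succ j.succ (0 : Fin (n + 1)) = 0 :=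
    Equiv.swap_apply_of_ne_of_ne (Fin.succ_ne_zero i).symm (Fin.succ_ne_zero j).symm
  have h := mulVec_mem_kobayashiIndicatrix (D' := pseudoEgg n m)
    (L := (Equiv.swap i.succ j.succ).permMatrix ℂ) (b := 0)
    (isOpen_pseudoEgg hm0) ((cons_zero_mem_pseudoEgg_iff hm0).mpr hp) (fun z hz => ?_) hv
  · convert h using 2
    ext k
    refine Fin.cases ?_ (fun k => ?_) k <;> simp [Matrix.permMatrix_mulVec, hsucc, hzero]
  · have hz' : ‖z 0‖ ^ (2 * m) + ∑ k : Fin n, ‖z k.succ‖ ^ 2 < 1 := hz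
    simp only [pseudoEgg, Set.mem_ofPred_eq, Matrix.permMatrix_mulVec, add_zero,
      Function.comp_apply, hsucc, hzero]
    rwa [Equiv.sum_comp (Equiv.swap i j) fun k => ‖z k.succ‖ ^ 2]

lemma IsBestFit.apply_eq_zero (hm0 : 0 < m) {p : ℂ} (hp : ‖p‖ < 1)
    {H : Matrix (Fin (n + 1)) (Fin (n + 1)) ℂ} (hH : IsBestFit (eggIndicatrix n m p) H)
    {i j : Fin (n + 1)} (hij : i ≠ j) : H i j = 0 := by
  have key : ∀ k : Fin (n + 1), k ≠ 0 → (k = i ∨ k = j) → H i j = 0 := by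
    intro k hk hkij
    -- Reversing the sign of coordinate `k ≠ 0` fixes `(p, 0)` and negates `H i j`, since exactly
    -- one of `i`, `j` is `k`.
    set d : Fin (n + 1) → ℂ := Function.update 1 k (-1) with hd
    have hn : ∀ l, ‖d l‖ = 1 := by
      intro l
      by_cases h : l = k
      · subst h; simp [hd]
      · simp [hd, h]
    have h := hH.conjTranspose_mul_mul_eq (S := Matrix.diagonal d)
      (by simp [Matrix.det_diagonal, hn]) (diagonal_mulVec_mem_eggIndicatrix hm0 hp
        (by simp [hd, hk.symm]) hn)
    have h' := congrFun (congrFun h i) j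
    rw [Matrix.diagonal_conjTranspose, Matrix.mul_diagonal, Matrix.diagonal_mul] at h'
    rcases hkij with rfl | rfl
    · simp [hd, hij.symm] at h'
      linear_combination (-1 / 2 : ℂ) * h'
    · simp [hd, hij] at h'
      linear_combination (-1 / 2 : ℂ) * h'
  by_cases hi : i = 0
  · exact key j (fun hj => hij (hi.trans hj.symm)) (Or.inr rfl)
  · exact key i hi (Or.inl rfl)

lemma IsBestFit.apply_succ_eq_apply_succ (hm0 : 0 < m) {p : ℂ} (hp : ‖p‖ < 1)
    {H : Matrix (Fin (n + 1)) (Fin (n + 1)) ℂ} (hH : IsBestFit (eggIndicatrix n m p) H)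
    (i j : Fin n) : H i.succ i.succ = H j.succ j.succ := by
  have h := hH.conjTranspose_mul_mul_eq (S := (Equiv.swap j.succ i.succ).permMatrix ℂ)
    (by rw [Matrix.det_permutation]; rcases Int.units_eq_one_or (Equiv.Perm.sign
          (Equiv.swap j.succ i.succ)) with h | h <;> simp [h])
    (permMatrix_mulVec_mem_eggIndicatrix hm0 hp j i)
  have h' := congrFun (congrFun h j.succ) j.succ
  rw [Matrix.conjTranspose_permMatrix, Equiv.Perm.permMatrix, Equiv.Perm.permMatrix,
    PEquiv.toMatrix_toPEquiv_mul, PEquiv.mul_toMatrix_toPEquiv] at h'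
  simpa using h'

/-- The index `Fin.last n` stands for any later coordinate. When `n = 0` it is `0` and the sum is
empty, so the coefficient is still a positive diagonal entry. -/
lemma IsBestFit.hermitianSphere_eq (hm0 : 0 < m) {p : ℂ} (hp : ‖p‖ < 1)
    {H : Matrix (Fin (n + 1)) (Fin (n + 1)) ℂ} (hH : IsBestFit (eggIndicatrix n m p) H) :
    hermitianSphere H = {v | (H 0 0).re * ‖v 0‖ ^ 2 +
      (H (Fin.last n) (Fin.last n)).re * ∑ i : Fin n, ‖v i.succ‖ ^ 2 = 1} := by
  have hlast : ∀ i : Fin n, H i.succ i.succ = H (Fin.last n) (Fin.last n) := by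
    intro i
    obtain ⟨k, rfl⟩ : ∃ k, n = k + 1 := ⟨n - 1, by have := i.pos; omega⟩
    exact hH.apply_succ_eq_apply_succ hm0 hp i (Fin.last k)
  have hdiag : H = Matrix.diagonal fun i => ((H i i).re : ℂ) := by
    ext i j
    by_cases hij : i = j
    · subst hij
      rw [Matrix.diagonal_apply_eq]
      exact (hH.posDef.isHermitian.coe_re_apply_self i).symm
    · rw [Matrix.diagonal_apply_ne _ hij, hH.apply_eq_zero hm0 hp hij]
  ext v
  have e : hermitianSq H v = (H 0 0).re * ‖v 0‖ ^ 2 +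
      (H (Fin.last n) (Fin.last n)).re * ∑ i : Fin n, ‖v i.succ‖ ^ 2 := by
    conv_lhs => rw [hdiag]
    rw [hermitianSq_diagonal, Fin.sum_univ_succ, Finset.mul_sum]
    simp only [hlast]
  simp only [hermitianSphere, Set.mem_ofPred_eq, e]

/-- Moving `w` towards `1` by the fraction `ε` moves `w ^ a` towards `1` by at most the fraction `2
/ a * ε ^ a`. Bernoulli's inequality reduces this to a bound in `1 - w`, proved by subadditivity of
the power for `w ≤ 1 / 2` and by Bernoulli again for `w ≥ 1 / 2`. -/
lemma add_mul_one_sub_rpow_le {a : ℝ} (ha : 0 < a) (ha1 : a ≤ 1) {w ε : ℝ} (hw : 0 ≤ w)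
    (hw1 : w ≤ 1) (hε : 0 ≤ ε) (hε1 : ε ≤ 1) :
    (w + ε * (1 - w)) ^ a ≤ w ^ a + 2 / a * ε ^ a * (1 - w ^ a) := by
  have hu : 0 ≤ 1 - w := by linarith
  have hεa : 0 ≤ ε ^ a := by positivity
  have hεle : ε ≤ ε ^ a := by
    simpa using Real.rpow_le_rpow_of_exponent_ge' hε hε1 ha.le ha1
  have hbern : a * (1 - w) ≤ 1 - w ^ a := by
    have := rpow_one_add_le_one_add_mul_self (s := w - 1) (by linarith) ha.le ha1
    rw [add_sub_cancel] at this
    linarith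
  have hright : 2 * ε ^ a * (1 - w) ≤ 2 / a * ε ^ a * (1 - w ^ a) := by
    calc 2 * ε ^ a * (1 - w) = 2 / a * ε ^ a * (a * (1 - w)) := by field_simp
      _ ≤ _ := by gcongr
  suffices h : (w + ε * (1 - w)) ^ a ≤ w ^ a + 2 * ε ^ a * (1 - w) by linarith
  rcases le_total w (1 / 2) with hw2 | hw2
  · have h1 : (ε * (1 - w)) ^ a ≤ ε ^ a :=
      Real.rpow_le_rpow (by positivity) (by nlinarith) ha.le
    have h2 := Real.rpow_add_le_add_rpow hw (by positivity : 0 ≤ ε * (1 - w)) ha.le ha1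
    nlinarith
  · have hw0 : 0 < w := by linarith
    have hwa1 : w ^ a ≤ 1 := Real.rpow_le_one hw hw1 ha.le
    have hwa0 : 0 ≤ w ^ a := by positivity
    set t := ε * (1 - w) / w with ht
    have ht0 : 0 ≤ t := by positivity
    have ht2 : t ≤ 2 * (ε * (1 - w)) := by
      rw [ht, div_le_iff₀ hw0]
      nlinarith [mul_nonneg hε hu]
    have hb := rpow_one_add_le_one_add_mul_self (s := t) (by linarith) ha.le ha1
    calc (w + ε * (1 - w)) ^ a = w ^ a * (1 + t) ^ a := by
          rw [← Real.mul_rpow hw (by linarith), ht]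
          congr 1; field_simp
      _ ≤ w ^ a * (1 + a * t) := by gcongr
      _ ≤ w ^ a + t := by nlinarith [mul_le_mul hwa1 ha1 ha.le zero_le_one]
      _ ≤ w ^ a + 2 * (ε * (1 - w)) := by linarith
      _ ≤ w ^ a + 2 * ε ^ a * (1 - w) := by nlinarith

/-- The linear part of the affine self-maps of the egg that move `(q, 0)` to a nearby `(p, 0)`. -/
noncomputable def eggContraction (n : ℕ) (m ε : ℝ) : Matrix (Fin (n + 1)) (Fin (n + 1)) ℂ :=
  Matrix.diagonal (Fin.cons ((1 - ε : ℝ) : ℂ) fun _ => (√(1 - ε ^ (2 * m) / m) : ℂ))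

/-- Translating the first coordinate uses up at most the fraction `δ = ε ^ (2 * m) / m` of the slack
`1 - ‖z 0‖ ^ (2 * m)`. Scaling the other squared norms by `1 - δ` makes up for it. The power
inequality applies because `2 * m ≤ 1`. -/
lemma eggContraction_mulVec_add_mem (hm0 : 0 < m) (hm : m < 1 / 2) {ε : ℝ} (hε : 0 ≤ ε)
    (hε1 : ε ≤ 1) (hεm : ε ^ (2 * m) / m < 1) {c : ℂ} (hc : ‖c‖ ≤ ε) {z : Fin (n + 1) → ℂ}
    (hz : z ∈ pseudoEgg n m) :
    eggContraction n m ε *ᵥ z + (Fin.cons c 0 : Fin (n + 1) → ℂ) ∈ pseudoEgg n m := by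
  have hz' : ‖z 0‖ ^ (2 * m) + ∑ i : Fin n, ‖z i.succ‖ ^ 2 < 1 := hz
  have hw1 : ‖z 0‖ ≤ 1 :=
    (norm_le_pi_norm z 0).trans (mem_closedBall_zero_iff.mp (pseudoEgg_subset_closedBall hm0 hz))
  set δ := ε ^ (2 * m) / m with hδ
  have hsq : ‖((√(1 - δ) : ℝ) : ℂ)‖ ^ 2 = 1 - δ := by
    rw [Complex.norm_real, Real.norm_of_nonneg (Real.sqrt_nonneg _), Real.sq_sqrt (by linarith)]
  have h0 : ‖((1 - ε : ℝ) : ℂ) * z 0 + c‖ ≤ ‖z 0‖ + ε * (1 - ‖z 0‖) := by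
    refine (norm_add_le _ _).trans ?_
    rw [norm_mul, Complex.norm_real, Real.norm_of_nonneg (by linarith)]
    linarith
  have h1 : ‖((1 - ε : ℝ) : ℂ) * z 0 + c‖ ^ (2 * m) ≤
      ‖z 0‖ ^ (2 * m) + δ * (1 - ‖z 0‖ ^ (2 * m)) := by
    refine (Real.rpow_le_rpow (norm_nonneg _) h0 (by positivity)).trans ?_
    have := add_mul_one_sub_rpow_le (a := 2 * m) (by positivity) (by linarith) (norm_nonneg (z 0))
      hw1 hε hε1
    have e : 2 / (2 * m) * ε ^ (2 * m) = δ := by rw [hδ]; field_simp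
    rwa [e] at this
  have goal : ‖((1 - ε : ℝ) : ℂ) * z 0 + c‖ ^ (2 * m) +
      ∑ i : Fin n, ‖((√(1 - δ) : ℝ) : ℂ) * z i.succ‖ ^ 2 < 1 := by
    simp only [norm_mul, mul_pow, hsq, ← Finset.mul_sum]
    nlinarith
  simpa [pseudoEgg, eggContraction, Matrix.mulVec_diagonal] using goal

lemma eggContraction_mulVec_mem_eggIndicatrix (hm0 : 0 < m) (hm : m < 1 / 2) {p q : ℂ}
    (hq : ‖q‖ < 1) {ε : ℝ} (hε : ε = ‖p - q‖ / (1 - ‖q‖)) (hε1 : ε ≤ 1)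
    (hεm : ε ^ (2 * m) / m < 1) :
    ∀ v ∈ eggIndicatrix n m q, eggContraction n m ε *ᵥ v ∈ eggIndicatrix n m p := by
  intro v hv
  have hε0 : 0 ≤ ε := by
    rw [hε]; exact div_nonneg (norm_nonneg _) (by linarith)
  -- The translation must send `(1 - ε) * q` to `p`; the value of `ε` is the one for which the
  -- triangle inequality gives exactly `‖c‖ ≤ ε`.
  have hc : ‖p - ((1 - ε : ℝ) : ℂ) * q‖ ≤ ε := by
    have e : p - ((1 - ε : ℝ) : ℂ) * q = (p - q) + (ε : ℂ) * q := by push_cast; ring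
    have h1 : ‖p - q‖ = ε * (1 - ‖q‖) := by
      rw [hε, div_mul_cancel₀ _ (by linarith)]
    rw [e]
    refine (norm_add_le _ _).trans ?_
    rw [norm_mul, Complex.norm_real, Real.norm_of_nonneg hε0, h1]
    linarith
  have h := mulVec_mem_kobayashiIndicatrix (isOpen_pseudoEgg hm0)
    ((cons_zero_mem_pseudoEgg_iff hm0).mpr hq)
    (fun z hz => eggContraction_mulVec_add_mem hm0 hm hε0 hε1 hεm hc hz) hv
  convert h using 2
  ext i
  refine Fin.cases ?_ (fun i => ?_) i <;> simp [Matrix.mulVec_diagonal, eggContraction]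

lemma tendsto_eggContraction (hm0 : 0 < m) :
    Tendsto (eggContraction n m) (𝓝 0) (𝓝 1) := by
  have h1 : eggContraction n m 0 = 1 := by
    unfold eggContraction
    rw [← Matrix.diagonal_one]
    congr 1
    ext i
    refine Fin.cases ?_ (fun i => ?_) i <;> simp [Real.zero_rpow (by positivity : 2 * m ≠ 0)]
  have hcont : Continuous (eggContraction n m) := by
    unfold eggContraction
    refine Continuous.matrix_diagonal (continuous_pi fun i => ?_)
    refine Fin.cases ?_ (fun i => ?_) i
    · simp only [Fin.cons_zero]
      fun_prop
    · simp only [Fin.cons_succ]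
      have : Continuous fun ε : ℝ => ε ^ (2 * m) :=
        continuous_id.rpow_const fun _ => Or.inr (by positivity)
      fun_prop
  simpa [h1] using hcont.tendsto 0

lemma exists_isBestFit_eggIndicatrix (hm0 : 0 < m) {p : ℂ} (hp : ‖p‖ < 1) :
    ∃ H, IsBestFit (eggIndicatrix n m p) H := by
  have hmem := (cons_zero_mem_pseudoEgg_iff (n := n) hm0).mpr hp
  obtain ⟨δ, hδ, hball⟩ :=
    exists_closedBall_subset_kobayashiIndicatrix (isOpen_pseudoEgg hm0) hmem
  exact exists_isBestFit hδ hball (kobayashiIndicatrix_subset_closedBall (isOpen_pseudoEgg hm0)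
    (pseudoEgg_subset_closedBall hm0) hmem)

/-- The best fitting ellipsoid at `(p, 0)` depends continuously on `p`. -/
lemma continuousOn_isBestFit_eggIndicatrix (hm0 : 0 < m) (hm : m < 1 / 2)
    {H : ℂ → Matrix (Fin (n + 1)) (Fin (n + 1)) ℂ}
    (hH : ∀ p, ‖p‖ < 1 → IsBestFit (eggIndicatrix n m p) (H p)) :
    ContinuousOn H {p | ‖p‖ < 1} := by
  intro p hp
  have hp' : ‖p‖ < 1 := hp
  obtain ⟨δ, hδ, hball⟩ := exists_closedBall_subset_kobayashiIndicatrix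
    (isOpen_pseudoEgg (n := n) hm0) ((cons_zero_mem_pseudoEgg_iff hm0).mpr hp')
  have hin : ∀ᶠ q : ℂ in 𝓝 p, ‖q‖ < 1 :=
    (isOpen_lt continuous_norm continuous_const).mem_nhds hp'
  have hε₁ : Tendsto (fun q : ℂ => ‖p - q‖ / (1 - ‖q‖)) (𝓝 p) (𝓝 0) := by
    have : ContinuousAt (fun q : ℂ => ‖p - q‖ / (1 - ‖q‖)) p :=
      ContinuousAt.div (by fun_prop) (by fun_prop) (by linarith)
    simpa [ContinuousAt] using this
  have hε₂ : Tendsto (fun q : ℂ => ‖q - p‖ / (1 - ‖p‖)) (𝓝 p) (𝓝 0) := by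
    have : ContinuousAt (fun q : ℂ => ‖q - p‖ / (1 - ‖p‖)) p := by fun_prop
    simpa [ContinuousAt] using this
  have hsmall : ∀ᶠ ε : ℝ in 𝓝 0, ε ≤ 1 ∧ ε ^ (2 * m) / m < 1 := by
    have h : ContinuousAt (fun ε : ℝ => ε ^ (2 * m) / m) 0 :=
      (continuousAt_id.rpow_const (Or.inr (by positivity))).div_const m
    refine (eventually_le_nhds zero_lt_one).and (h.eventually_lt_const ?_)
    simp [Real.zero_rpow (by positivity : 2 * m ≠ 0)]
  have hlim : Tendsto H (𝓝 p) (𝓝 (H p)) := by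
    refine IsBestFit.tendsto (I := eggIndicatrix n m) hδ hball (hH p hp') (hin.mono hH)
      ((tendsto_eggContraction hm0).comp hε₁) ((tendsto_eggContraction hm0).comp hε₂) ?_ ?_
    · filter_upwards [hin, hε₁.eventually hsmall] with q hq hεq
      exact eggContraction_mulVec_mem_eggIndicatrix hm0 hm hq rfl hεq.1 hεq.2
    · filter_upwards [hε₂.eventually hsmall] with q hεq
      exact eggContraction_mulVec_mem_eggIndicatrix hm0 hm hp' rfl hεq.1 hεq.2
  exact hlim.mono_left nhdsWithin_le_nhds

end PseudoEgg

theorem mainTheorem8 (n : ℕ) (m : ℝ) (hm0 : 0 < m) (hm : m < 1 / 2) :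
    ∃ r₁ r₂ : ℂ → ℝ,
      ContinuousOn r₁ {p : ℂ | (Fin.cons p 0 : Fin (n + 1) → ℂ) ∈ pseudoEgg n m} ∧
      ContinuousOn r₂ {p : ℂ | (Fin.cons p 0 : Fin (n + 1) → ℂ) ∈ pseudoEgg n m} ∧
      ∀ p : ℂ, (Fin.cons p 0 : Fin (n + 1) → ℂ) ∈ pseudoEgg n m →
        0 < r₁ p ∧ 0 < r₂ p ∧
        ∃ H : Matrix (Fin (n + 1)) (Fin (n + 1)) ℂ,
          IsWuMetricAt (pseudoEgg n m) (Fin.cons p 0) H ∧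
          (∀ H' : Matrix (Fin (n + 1)) (Fin (n + 1)) ℂ,
            IsWuMetricAt (pseudoEgg n m) (Fin.cons p 0) H' → H' = H) ∧
          hermitianSphere H =
            {v | r₁ p * ‖v 0‖ ^ 2 + r₂ p * ∑ i : Fin n, ‖v i.succ‖ ^ 2 = 1} := by
  have hex : ∀ p : ℂ, ∃ H, ‖p‖ < 1 → IsBestFit (eggIndicatrix n m p) H := by
    intro p
    by_cases hp : ‖p‖ < 1
    · obtain ⟨H, hH⟩ := exists_isBestFit_eggIndicatrix (n := n) hm0 hp
      exact ⟨H, fun _ => hH⟩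
    -- Off the disc the value is arbitrary: continuity is claimed only on it.
    · exact ⟨0, fun h => absurd h hp⟩
  choose H hH using hex
  have hcont := continuousOn_isBestFit_eggIndicatrix hm0 hm hH
  simp only [cons_zero_mem_pseudoEgg_iff hm0]
  have hentry : ∀ i : Fin (n + 1), ContinuousOn (fun p => (H p i i).re) {p | ‖p‖ < 1} := fun i =>
    (Complex.continuous_re.comp (continuous_id.matrix_elem i i)).comp_continuousOn hcont
  have hpos : ∀ p, ‖p‖ < 1 → ∀ i, 0 < (H p i i).re := fun p hp i =>
    (Complex.lt_def.mp ((hH p hp).posDef.diag_pos (i := i))).1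
  refine ⟨fun p => (H p 0 0).re, fun p => (H p (Fin.last n) (Fin.last n)).re, hentry 0,
    hentry (Fin.last n), fun p hp => ⟨hpos p hp 0, hpos p hp _, H p,
      isWuMetricAt_iff_isBestFit.mpr (hH p hp), fun H' hH' => ?_,
      (hH p hp).hermitianSphere_eq hm0 hp⟩⟩
  exact (isWuMetricAt_iff_isBestFit.mp hH').unique (hH p hp)
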